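/- Let $(\Omega,\mu)$ be a measure space, $H=L^2(\Omega,\mu)$ the real Lebesgue space with its a.e. order, $T>0$, and let $V,W$ be real Hilbert spaces which are continuously and densely embedded in $H$. Put $v^+=\max\{v,0\}$, $v^-=(-v)^+$, $V_+=\{v\in V: v\ge 0\}$, $W_+=\{w\in W:w\ge 0\}$. A non-autonomous closed form on $V$ is a family of bilinear forms $\mathfrak a(t,\cdot,\cdot):V\times V\to\mathbb R$ $(t\in[0,T])$ for which there are constants $M,\omega\in\mathbb R$ and $\alpha>0$ such that $|\mathfrak a(t,u,v)|\le M\|u\|_V\|v\|_V$ and $\mathfrak a(t,u,u)+\omega\|u\|_H^2\ge\alpha\|u\|_V^2$ for all $t\in[0,T]$, $u,v\in V$, and such that $\mathfrak a(\cdot,u,v)$ is measurable for all $u,v\in V$. Given $f\in L^2(0,T;V')$ and $u_0\in H$, a solution of $\dot u(t)+\mathcal A(t)u(t)=f(t)$, $u(0)=u_0$, where $\langle\mathcal A(t)v,z\rangle=\mathfrak a(t,v,z)$, is a function $u\in H^1(0,T;V')\cap L^2(0,T;V)$ (with $V\hookrightarrow H\hookrightarrow V'$, and identified with its representative in $C([0,T];H)$)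 which satisfies the equation in $V'$ for a.e. $t$ and has $u(0)=u_0$. Let $\mathfrak a$ be a non-autonomous closed form on $V$ and $\mathfrak b$ a non-autonomous closed form on $W$. Assume: * $V$ and $W$ are sublattices of $H$, i.e. $v\in V$ implies $v^+\in V$, and $w\in W$ implies $w^+\in W$; * $V$ is an ideal of $W$, i.e. $V\subset W$, and $v\in V$, $w\in W$, $0\le w\le v$ imply $w\in V$; * for a.e. $t\in[0,T]$: $\mathfrak a(t,v^+,v^-)\le 0$ for all $v\in V$, and $\mathfrak b(t,w^+,w^-)\le 0$ for all $w\in W$; * for a.e. $t\in[0,T]$: $\mathfrak b(t,u,v)\le\mathfrak a(t,u,v)$ for all $u,v\in V_+$. Let $u_0,v_0\in H$ with $0\le u_0\le v_0$, and let $f\in L^2(0,T;V')$ and $g\in L^2(0,T;W')$ be such that $f\le g$, i.e. for a.e. $t$, $\langle f(t),v\rangle\le\langle g(t),v\rangle$ for all $v\in V_+$, and $g\ge 0$, i.e. for a.e. $t$, $\langle g(t),w\rangle\ge 0$ for all $w\in W_+$. Let $u$ be the solution of $\dot u+\mathcal A(t)u=f$, $u(0)=u_0$, and let $v$ be the solution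 of $\dot v+\mathcal B(t)v=g$, $v(0)=v_0$, where $\langle\mathcal B(t)w,z\rangle=\mathfrak b(t,w,z)$. Then $u(t)\le v(t)$ ($\mu$-a.e.) for all $t\in[0,T]$. -/

import Mathlib

open MeasureTheory Set
open scoped ContDiff ENNReal

namespace NonautForm

section Abstract

variable {V H : Type*} [NormedAddCommGroup V] [InnerProductSpace ℝ V]
  [NormedAddCommGroup H] [InnerProductSpace ℝ H]

/-- Lebesgue measure on the time interval `(0,T)`. -/
noncomputable def timeMeasure (T : ℝ) : Measure ℝ := volume.restrict (Ioo 0 T)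

/-- `j` is a continuous dense embedding of the space `V` into `H`
(continuity is part of the type of `j`). -/
structure IsDenseEmbedding (j : V →L[ℝ] H) : Prop where
  injective : Function.Injective j
  dense : DenseRange j

/-- The embedding `V ↪ H ↪ V'`, `v ↦ (z ↦ (v | z)_H)`. -/
noncomputable def embedDual (j : V →L[ℝ] H) (v : V) : StrongDual ℝ V :=
  (innerSL ℝ (j v)).comp j

/-- A family of bilinear forms `a(t,·,·)` on `V` is a non-autonomous closed form on `H`:
it is uniformly `V`-bounded, uniformly quasi-coercive, and measurable in time. -/
structure IsNonautonomousClosedForm (T : ℝ) (j : V →L[ℝ] H)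
    (a : ℝ → V →ₗ[ℝ] V →ₗ[ℝ] ℝ) : Prop where
  bounded : ∃ M : ℝ, ∀ t ∈ Icc 0 T, ∀ u v : V, |a t u v| ≤ M * ‖u‖ * ‖v‖
  quasiCoercive : ∃ α : ℝ, 0 < α ∧ ∃ w : ℝ, ∀ t ∈ Icc 0 T, ∀ u : V,
    α * ‖u‖ ^ 2 ≤ a t u u + w * ‖j u‖ ^ 2
  measurable : ∀ u v : V, AEMeasurable (fun t => a t u v) (timeMeasure T)

/-- `z'` is the weak derivative on `(0,T)` of the `E`-valued function `z`. -/
def IsWeakDeriv {E : Type*} [NormedAddCommGroup E] [NormedSpace ℝ E]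
    (T : ℝ) (z z' : ℝ → E) : Prop :=
  ∀ φ : ℝ → ℝ, ContDiff ℝ ∞ φ → HasCompactSupport φ → tsupport φ ⊆ Ioo 0 T →
    -(∫ s, deriv φ s • z s ∂(timeMeasure T)) = ∫ s, φ s • z' s ∂(timeMeasure T)

/-- `y ∈ MR(V,V') = H¹(0,T;V') ∩ L²(0,T;V)`, with derivative `y' ∈ L²(0,T;V')`. -/
structure IsMR (T : ℝ) (j : V →L[ℝ] H) (y : ℝ → V) (y' : ℝ → StrongDual ℝ V) : Prop where
  memLp : MemLp y 2 (timeMeasure T)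
  memLp_deriv : MemLp y' 2 (timeMeasure T)
  weakDeriv : IsWeakDeriv T (fun s => embedDual j (y s)) y'

/-- `u : [0,T] → H` is (the representative in `C([0,T];H)` of) a solution in `MR(V,V')` of
`u' + A(t) u = f` a.e. on `(0,T)`, `u(0) = u₀`, where `⟨A(t)v, z⟩ = a(t,v,z)`. -/
def IsSolution (T : ℝ) (j : V →L[ℝ] H) (a : ℝ → V →ₗ[ℝ] V →ₗ[ℝ] ℝ)
    (f : ℝ → StrongDual ℝ V) (u₀ : H) (u : ℝ → H) : Prop :=
  ContinuousOn u (Icc 0 T) ∧ u 0 = u₀ ∧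
    ∃ (y : ℝ → V) (y' : ℝ → StrongDual ℝ V), IsMR T j y y' ∧
      (∀ᵐ t ∂(timeMeasure T), u t = j (y t)) ∧
      (∀ᵐ t ∂(timeMeasure T), ∀ z : V, y' t z + a t (y t) z = f t z)

end Abstract

section Lattice

variable {Ω : Type*} [MeasurableSpace Ω] {μ : Measure Ω}
  {V W : Type*} [NormedAddCommGroup V] [InnerProductSpace ℝ V]
  [NormedAddCommGroup W] [InnerProductSpace ℝ W]

/-- `V`, embedded in `L²(Ω,μ)` by `j`, is a sublattice: `v ∈ V` implies `v⁺ ∈ V`. -/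
def IsSublattice (j : V →L[ℝ] Lp ℝ 2 μ) : Prop :=
  ∀ v : V, (j v)⁺ ∈ range j

/-- `V` is an ideal of `W` (both embedded in `L²(Ω,μ)`): `V ⊆ W`, and
`0 ≤ w ≤ v`, `v ∈ V`, `w ∈ W` imply `w ∈ V`. -/
def IsIdealOf (j : V →L[ℝ] Lp ℝ 2 μ) (k : W →L[ℝ] Lp ℝ 2 μ) : Prop :=
  range j ⊆ range k ∧ ∀ (v : V) (w : W), 0 ≤ k w → k w ≤ j v → k w ∈ range j

/-- `a(t, v⁺, v⁻) ≤ 0` for a.e. `t` and all `v ∈ V`; here `p` and `m` are the elements of `V`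
representing `v⁺` and `v⁻`. -/
def IsPositivityPreserving (T : ℝ) (j : V →L[ℝ] Lp ℝ 2 μ)
    (a : ℝ → V →ₗ[ℝ] V →ₗ[ℝ] ℝ) : Prop :=
  ∀ᵐ t ∂(timeMeasure T), ∀ v p m : V, j p = (j v)⁺ → j m = (j v)⁻ → a t p m ≤ 0

/-- `b(t,u,v) ≤ a(t,u,v)` for a.e. `t` and all `u, v ∈ V₊`; here `u', v' ∈ W` are the
elements `u, v ∈ V ⊆ W`, regarded as elements of `W`. -/
def FormLE (T : ℝ) (j : V →L[ℝ] Lp ℝ 2 μ) (k : W →L[ℝ] Lp ℝ 2 μ)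
    (b : ℝ → W →ₗ[ℝ] W →ₗ[ℝ] ℝ) (a : ℝ → V →ₗ[ℝ] V →ₗ[ℝ] ℝ) : Prop :=
  ∀ᵐ t ∂(timeMeasure T), ∀ (u v : V) (u' v' : W), k u' = j u → k v' = j v →
    0 ≤ j u → 0 ≤ j v → b t u' v' ≤ a t u v

/-- `g ≥ 0` in `L²(0,T;W')`: for a.e. `t`, `⟨g(t), w⟩ ≥ 0` for all `0 ≤ w ∈ W`. -/
def IsPositive (T : ℝ) (k : W →L[ℝ] Lp ℝ 2 μ) (g : ℝ → StrongDual ℝ W) : Prop :=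
  ∀ᵐ t ∂(timeMeasure T), ∀ w : W, 0 ≤ k w → 0 ≤ g t w

/-- `f ≤ g` for `f ∈ L²(0,T;V')`, `g ∈ L²(0,T;W')`: for a.e. `t`,
`⟨f(t), v⟩ ≤ ⟨g(t), v⟩` for all `0 ≤ v ∈ V`; here `w ∈ W` is `v` regarded as an element
of `W`. -/
def SourceLE (T : ℝ) (j : V →L[ℝ] Lp ℝ 2 μ) (k : W →L[ℝ] Lp ℝ 2 μ)
    (f : ℝ → StrongDual ℝ V) (g : ℝ → StrongDual ℝ W) : Prop :=
  ∀ᵐ t ∂(timeMeasure T), ∀ (v : V) (w : W), k w = j v → 0 ≤ j v → f t v ≤ g t w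

end Lattice

end NonautForm

/-! Let x = u - v. The plan is to show that φ = ‖x⁺‖²/2 satisfies φ' ≤ 2κφ with φ(0) = 0 and to
conclude by Gronwall. Formally φ' = ⟨x', x⁺⟩, but the usual product rule does not apply directly: x
takes values only in W, while the equation for u can be tested only with elements of V. What remains
available is the test element. If v ≥ 0, then 0 ≤ (u - v)⁺ ≤ u⁺, so the ideal property puts w =
x(t)⁺ in V for a.e. t. Hence positivity of v is proved first, by the same scheme applied to -v.

The chain rule is replaced by an inequality. Convexity gives φ(t) - φ(t-h) ≤ (x(t) - x(t-h) |
x(t)⁺), where the test element is frozen at time t. Dividing by h and letting h → 0 at Lebesgue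
points of the dual derivatives bounds the upper left Dini derivative of φ by ⟨u', w⟩ - ⟨v', w⟩.
Since φ is not known to be absolutely continuous, this a.e. bound is integrated by Fatou's lemma
(`integral_le_sub_of_dini`). The integrable one-sided bound which Fatou needs comes from Young's
inequality and ‖w‖_V ≤ C(‖u‖_V + ‖v‖_W).

The form estimate is b(v,w) - a(u,w) ≤ κ‖w‖_H² (`FormLEAt.apply_sub_apply_le`). It combines the two
Beurling-Deny criteria with b ≤ a on positive elements. -/

namespace NonautForm

open Filter
open scoped Topology

/-! ### Integrating a Dini derivative bound -/

/-- The mean over `[a, b]` of the backward difference quotients of a continuous function tends to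
its increment. -/
theorem tendsto_integral_backward_quotient {Ψ : ℝ → ℝ} (hΨ : Continuous Ψ) (a b : ℝ) :
    Tendsto (fun h => ∫ t in a..b, h⁻¹ * (Ψ t - Ψ (t - h))) (𝓝[>] 0) (𝓝 (Ψ b - Ψ a)) := by
  have key : ∀ c : ℝ, Tendsto (fun h => h⁻¹ * ∫ t in (c - h)..c, Ψ t) (𝓝[>] 0) (𝓝 (Ψ c)) := by
    intro c
    have hd : HasDerivAt (fun h => ∫ t in (c - h)..c, Ψ t) (Ψ c) 0 := by
      have h1 : HasDerivAt (fun y => ∫ t in y..c, Ψ t) (-Ψ c) (c - 0) := by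
        have := intervalIntegral.integral_hasDerivAt_left
          (hΨ.intervalIntegrable (c - 0) c) (hΨ.stronglyMeasurableAtFilter _ _)
          hΨ.continuousAt
        simpa using this
      have h2 : HasDerivAt (fun h : ℝ => c - h) (-1) 0 := by
        simpa using (hasDerivAt_id (0 : ℝ)).const_sub c
      have h3 := h1.comp (0 : ℝ) h2
      rwa [neg_mul_neg, mul_one] at h3
    have := hd.tendsto_slope_zero_right
    simpa using this
  have h3 := (key b).sub (key a)
  refine h3.congr fun h => ?_
  rw [intervalIntegral.integral_const_mul, ← mul_sub]
  congr 1
  have i1 : ∀ x y, IntervalIntegrable Ψ volume x y := fun x y => hΨ.intervalIntegrable x y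
  rw [intervalIntegral.integral_sub (i1 _ _)
    (Continuous.intervalIntegrable (by fun_prop) _ _),
    intervalIntegral.integral_comp_sub_right (fun t => Ψ t) h,
    intervalIntegral.integral_interval_sub_interval_comm (i1 _ _) (i1 _ _) (i1 _ _)]
  rw [intervalIntegral.integral_symm a b, intervalIntegral.integral_symm (a - h) (b - h)]
  ring

/-- A continuous function whose backward difference quotients are bounded below by an integrable
function, and whose lower left Dini derivative is a.e. at least `K`, increases by at least the
integral of `K`. -/
theorem integral_le_sub_of_dini {Ψ K c : ℝ → ℝ} (hΨ : Continuous Ψ) {a b δ : ℝ} (hab : a ≤ b)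
    (hδ : 0 < δ) (hK : IntegrableOn K (Ioc a b)) (hc : IntegrableOn c (Ioc a b))
    (hlow : ∀ᵐ t ∂volume.restrict (Ioc a b), ∀ h ∈ Ioo 0 δ, -(h * c t) ≤ Ψ t - Ψ (t - h))
    (hdini : ∀ᵐ t ∂volume.restrict (Ioc a b), ∀ ε > 0, ∀ᶠ h in 𝓝[>] (0 : ℝ),
      h * (K t - ε) ≤ Ψ t - Ψ (t - h)) :
    ∫ t in a..b, K t ≤ Ψ b - Ψ a := by
  set ν := volume.restrict (Ioc a b)
  obtain ⟨u, -, hu_mem, hu_lim⟩ := exists_seq_strictAnti_tendsto' hδ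
  have hu : Tendsto u atTop (𝓝[>] 0) :=
    tendsto_nhdsWithin_iff.2 ⟨hu_lim, Eventually.of_forall fun n => (hu_mem n).1⟩
  let q : ℕ → ℝ → ℝ := fun n t => (u n)⁻¹ * (Ψ t - Ψ (t - u n))
  have hqc : ∀ n, Continuous (q n) := fun n => by fun_prop
  have hqi : ∀ n, IntegrableOn (q n) (Ioc a b) := fun n =>
    (hqc n).continuousOn.integrableOn_Icc.mono_set Ioc_subset_Icc_self
  have hnn : ∀ n, 0 ≤ᵐ[ν] fun t => q n t + c t := fun n => by
    filter_upwards [hlow] with t ht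
    have h0 := (hu_mem n).1
    have h1 := mul_le_mul_of_nonneg_left (ht (u n) (hu_mem n)) (inv_nonneg.2 h0.le)
    rw [mul_neg, inv_mul_cancel_left₀ h0.ne'] at h1
    change 0 ≤ (u n)⁻¹ * (Ψ t - Ψ (t - u n)) + c t
    linarith
  have hInt : ∀ n, ∫ t, (q n t + c t) ∂ν = (∫ t in a..b, q n t) + ∫ t, c t ∂ν := fun n => by
    rw [integral_add (hqi n) hc, intervalIntegral.integral_of_le hab]
  have hlim : Tendsto (fun n => ∫ t, (q n t + c t) ∂ν) atTop
      (𝓝 (Ψ b - Ψ a + ∫ t, c t ∂ν)) := by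
    simp_rw [hInt]
    exact ((tendsto_integral_backward_quotient hΨ a b).comp hu).add_const _
  have hlim0 : 0 ≤ Ψ b - Ψ a + ∫ t, c t ∂ν :=
    ge_of_tendsto' hlim fun n => integral_nonneg_of_ae (hnn n)
  -- Adding `c` makes the quotients nonnegative, so Fatou applies along `u n` → 0.
  have hF := lintegral_liminf_le' (μ := ν) (u := atTop)
    (f := fun n t => ENNReal.ofReal (q n t + c t))
    (fun n => ((hqi n).add hc).aestronglyMeasurable.aemeasurable.ennreal_ofReal)
  have hR : liminf (fun n => ∫⁻ t, ENNReal.ofReal (q n t + c t) ∂ν) atTop =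
      ENNReal.ofReal (Ψ b - Ψ a + ∫ t, c t ∂ν) := by
    refine Tendsto.liminf_eq ?_
    refine ((ENNReal.continuous_ofReal.tendsto _).comp hlim).congr fun n => ?_
    exact ofReal_integral_eq_lintegral_ofReal ((hqi n).add hc) (hnn n)
  have hL : ∫⁻ t, ENNReal.ofReal (K t + c t) ∂ν ≤
      ∫⁻ t, liminf (fun n => ENNReal.ofReal (q n t + c t)) atTop ∂ν := by
    refine lintegral_mono_ae ?_
    filter_upwards [hdini] with t ht
    have h1 : ∀ ε > 0, ENNReal.ofReal (K t + c t - ε) ≤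
        liminf (fun n => ENNReal.ofReal (q n t + c t)) atTop := fun ε hε => by
      refine le_liminf_of_le (by isBoundedDefault) ?_
      filter_upwards [hu.eventually (ht ε hε)] with n hn
      have h0 := (hu_mem n).1
      have h1 := mul_le_mul_of_nonneg_left hn (inv_nonneg.2 h0.le)
      rw [inv_mul_cancel_left₀ h0.ne'] at h1
      refine ENNReal.ofReal_le_ofReal ?_
      change K t + c t - ε ≤ (u n)⁻¹ * (Ψ t - Ψ (t - u n)) + c t
      linarith
    have h2 : Tendsto (fun ε => ENNReal.ofReal (K t + c t - ε)) (𝓝[>] (0 : ℝ))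
        (𝓝 (ENNReal.ofReal (K t + c t))) := by
      have h3 : Continuous fun ε : ℝ => ENNReal.ofReal (K t + c t - ε) :=
        ENNReal.continuous_ofReal.comp (continuous_const.sub continuous_id)
      simpa using (h3.tendsto 0).mono_left nhdsWithin_le_nhds
    exact le_of_tendsto h2 (eventually_nhdsWithin_of_forall fun ε hε => h1 ε hε)
  have h4 : ENNReal.ofReal (∫ t, (K t + c t) ∂ν) ≤ ENNReal.ofReal (Ψ b - Ψ a + ∫ t, c t ∂ν) := by
    refine le_trans ?_ (hL.trans (hF.trans hR.le))
    -- The sign of `K + c` is not known, and `ENNReal.ofReal` sees only its positive part, which has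
    -- the larger integral.
    have h5 : ∫ t, (K t + c t) ∂ν ≤ ∫ t, max (K t + c t) 0 ∂ν :=
      integral_mono (hK.add hc) (hK.add hc).pos_part fun t => le_max_left _ _
    refine (ENNReal.ofReal_le_ofReal h5).trans ?_
    have h6 := ofReal_integral_eq_lintegral_ofReal (hK.add hc).pos_part
      (Eventually.of_forall fun t => le_max_right _ _)
    simp only [Pi.add_apply] at h6
    rw [h6]
    refine lintegral_mono fun t => ?_
    rcases max_choice (K t + c t) 0 with h | h <;> simp [h]
  have h6 := (ENNReal.ofReal_le_ofReal_iff hlim0).1 h4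
  rw [integral_add hK hc] at h6
  rw [intervalIntegral.integral_of_le hab]
  linarith

/-! ### From the weak derivative to the fundamental theorem of calculus -/

section SmoothTransition

theorem deriv_smoothTransition_eq_zero {x : ℝ} (hx : x ∉ Ioo (0 : ℝ) 1) :
    deriv Real.smoothTransition x = 0 := by
  rcases lt_trichotomy x 0 with h | rfl | h
  · have : Real.smoothTransition =ᶠ[𝓝 x] fun _ => 0 := by
      filter_upwards [Iio_mem_nhds h] with y hy using Real.smoothTransition.zero_of_nonpos hy.le
    simpa using this.deriv_eq
  · refine IsLocalMin.deriv_eq_zero (Eventually.of_forall fun y => ?_)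
    simpa using Real.smoothTransition.nonneg y
  · rcases (not_lt.1 fun h1 => hx ⟨h, h1⟩).eq_or_lt with rfl | h1
    · refine IsLocalMax.deriv_eq_zero (Eventually.of_forall fun y => ?_)
      simpa using Real.smoothTransition.le_one y
    · have : Real.smoothTransition =ᶠ[𝓝 x] fun _ => 1 := by
        filter_upwards [Ioi_mem_nhds h1] with y hy
          using Real.smoothTransition.one_of_one_le (le_of_lt hy)
      simpa using this.deriv_eq

theorem continuous_deriv_smoothTransition : Continuous (deriv Real.smoothTransition) :=
  (Real.smoothTransition.contDiff (n := 1)).continuous_deriv le_rfl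

theorem integral_deriv_smoothTransition :
    ∫ x in (0 : ℝ)..1, deriv Real.smoothTransition x = 1 := by
  rw [intervalIntegral.integral_deriv_eq_sub
    (fun x _ => (Real.smoothTransition.contDiff (n := 1)).differentiable (by simp) x)
    (continuous_deriv_smoothTransition.intervalIntegrable _ _)]
  simp

theorem hasDerivAt_smoothTransition_scaled (c ε x : ℝ) :
    HasDerivAt (fun x => Real.smoothTransition (ε⁻¹ * (x - c)))
      (ε⁻¹ * deriv Real.smoothTransition (ε⁻¹ * (x - c))) x := by
  have h1 := ((Real.smoothTransition.contDiff (n := 1)).differentiable (by simp)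
    (ε⁻¹ * (x - c))).hasDerivAt
  have h2 : HasDerivAt (fun x : ℝ => ε⁻¹ * (x - c)) ε⁻¹ x := by
    simpa using ((hasDerivAt_id x).sub_const c).const_mul ε⁻¹
  rw [mul_comm]
  exact h1.comp x h2

variable {E : Type*} [NormedAddCommGroup E] [NormedSpace ℝ E]

/-- The derivative of the scaled transition is a mollifier of mass one supported in [c, c + ε];
rescaling moves ε into the argument of `Z`, so that the limit ε → 0 is one of continuity. -/
theorem setIntegral_deriv_smoothTransition_smul {T c ε : ℝ} (hε : 0 < ε) (hc : 0 ≤ c)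
    (hcT : c + ε ≤ T) (Z : ℝ → E) :
    ∫ x in Ioo 0 T, (ε⁻¹ * deriv Real.smoothTransition (ε⁻¹ * (x - c))) • Z x =
      ∫ y in (0 : ℝ)..1, deriv Real.smoothTransition y • Z (c + ε * y) := by
  set G : ℝ → E := fun x => (ε⁻¹ * deriv Real.smoothTransition (ε⁻¹ * (x - c))) • Z x with hG
  have h0 : ∀ x, x ∉ Ioo c (c + ε) → G x = 0 := fun x hx => by
    have : deriv Real.smoothTransition (ε⁻¹ * (x - c)) = 0 := by
      refine deriv_smoothTransition_eq_zero fun h => hx ⟨?_, ?_⟩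
      · have := pos_of_mul_pos_right h.1 (inv_nonneg.2 hε.le)
        linarith
      · have := mul_lt_mul_of_pos_left h.2 hε
        rw [mul_inv_cancel_left₀ hε.ne'] at this
        linarith
    simp [hG, this]
  have h1 : ∫ x in Ioo 0 T, G x = ∫ x in c..(c + ε), G x := by
    rw [intervalIntegral.integral_of_le (by linarith), integral_Ioc_eq_integral_Ioo]
    refine (setIntegral_eq_of_subset_of_forall_sdiff_eq_zero measurableSet_Ioo
      (Ioo_subset_Ioo hc hcT) fun x hx => h0 x hx.2)
  rw [h1]
  have h2 := intervalIntegral.smul_integral_comp_add_mul (a := 0) (b := 1) G ε c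
  rw [mul_zero, add_zero, mul_one] at h2
  rw [← h2, ← intervalIntegral.integral_smul]
  refine intervalIntegral.integral_congr fun y _ => ?_
  simp only [hG, add_sub_cancel_left, inv_mul_cancel_left₀ hε.ne', smul_smul,
    mul_inv_cancel_left₀ hε.ne']

theorem tendsto_integral_deriv_smoothTransition_smul [CompleteSpace E] {Z : ℝ → E}
    (hZ : Continuous Z) (c : ℝ) :
    Tendsto (fun ε : ℝ => ∫ y in (0 : ℝ)..1, deriv Real.smoothTransition y • Z (c + ε * y))
      (𝓝 0) (𝓝 (Z c)) := by
  have h1 : Continuous fun ε : ℝ =>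
      ∫ y in (0 : ℝ)..1, deriv Real.smoothTransition y • Z (c + ε * y) := by
    refine intervalIntegral.continuous_parametric_intervalIntegral_of_continuous' ?_ 0 1
    have := continuous_deriv_smoothTransition
    fun_prop
  have h2 := h1.tendsto 0
  simpa [intervalIntegral.integral_smul_const, integral_deriv_smoothTransition] using h2

theorem tendsto_smoothTransition_scaled (c x : ℝ) :
    Tendsto (fun ε => Real.smoothTransition (ε⁻¹ * (x - c))) (𝓝[>] 0)
      (𝓝 ((Ioi c).indicator 1 x)) := by
  by_cases hx : c < x
  · refine tendsto_const_nhds.congr' ?_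
    filter_upwards [Ioo_mem_nhdsGT (sub_pos.2 hx)] with ε hε
    rw [indicator_of_mem (mem_Ioi.2 hx), Pi.one_apply, Real.smoothTransition.one_of_one_le]
    rw [inv_mul_eq_div, le_div_iff₀ hε.1]
    linarith [hε.2]
  · refine tendsto_const_nhds.congr' ?_
    filter_upwards [self_mem_nhdsWithin] with ε hε
    rw [indicator_of_notMem (by simpa using hx), Real.smoothTransition.zero_of_nonpos]
    exact mul_nonpos_of_nonneg_of_nonpos (inv_nonneg.2 (le_of_lt hε)) (by linarith)

/-- Testing a weak derivative against smooth approximations of the indicator of `(s, t]`. -/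
theorem IsWeakDeriv.sub_eq_integral_of_mem_Ioo [CompleteSpace E] {T : ℝ} {z z' Z : ℝ → E}
    (h : IsWeakDeriv T z z') (hz' : Integrable z' (timeMeasure T)) (hZ : Continuous Z)
    (hzZ : ∀ᵐ t ∂timeMeasure T, z t = Z t) {s t : ℝ} (hs : 0 < s) (hst : s ≤ t) (ht : t < T) :
    Z t - Z s = ∫ r in s..t, z' r := by
  -- A smooth plateau that rises on [s, s + ε] and falls on [t, t + ε]; its support stays inside (0,
  -- T) once ε < T - t.
  let φ : ℝ → ℝ → ℝ := fun ε x =>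
    Real.smoothTransition (ε⁻¹ * (x - s)) - Real.smoothTransition (ε⁻¹ * (x - t))
  have hφd : ∀ ε x, deriv (φ ε) x = ε⁻¹ * deriv Real.smoothTransition (ε⁻¹ * (x - s)) -
      ε⁻¹ * deriv Real.smoothTransition (ε⁻¹ * (x - t)) := fun ε x =>
    ((hasDerivAt_smoothTransition_scaled s ε x).sub
      (hasDerivAt_smoothTransition_scaled t ε x)).deriv
  have hφs : ∀ ε, ContDiff ℝ ∞ (φ ε) := fun ε => by
    have := Real.smoothTransition.contDiff (n := ⊤)
    exact (this.comp (contDiff_const.mul (contDiff_id.sub contDiff_const))).sub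
      (this.comp (contDiff_const.mul (contDiff_id.sub contDiff_const)))
  have hsupp : ∀ ε > 0, tsupport (φ ε) ⊆ Icc s (t + ε) := fun ε hε => by
    refine closure_minimal (fun x hx => ?_) isClosed_Icc
    by_contra hx'
    refine hx ?_
    rw [mem_Icc, not_and_or, not_le, not_le] at hx'
    have hi : 0 ≤ ε⁻¹ := inv_nonneg.2 hε.le
    rcases hx' with hx' | hx'
    · simp only [φ]
      rw [Real.smoothTransition.zero_of_nonpos
        (mul_nonpos_of_nonneg_of_nonpos hi (by linarith)),
        Real.smoothTransition.zero_of_nonpos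
        (mul_nonpos_of_nonneg_of_nonpos hi (by linarith)), sub_zero]
    · simp only [φ]
      rw [Real.smoothTransition.one_of_one_le, Real.smoothTransition.one_of_one_le, sub_self]
      all_goals
        rw [inv_mul_eq_div, le_div_iff₀ hε]
        linarith
  have hlhs : ∀ ε ∈ Ioo 0 (T - t), ∫ r, deriv (φ ε) r • z r ∂timeMeasure T =
      (∫ y in (0 : ℝ)..1, deriv Real.smoothTransition y • Z (s + ε * y)) -
        ∫ y in (0 : ℝ)..1, deriv Real.smoothTransition y • Z (t + ε * y) := fun ε hε => by
    rw [← setIntegral_deriv_smoothTransition_smul (T := T) hε.1 hs.le (by linarith [hε.2]) Z,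
      ← setIntegral_deriv_smoothTransition_smul (T := T) hε.1 (by linarith) (by linarith [hε.2]) Z,
      ← integral_sub]
    · refine integral_congr_ae ?_
      filter_upwards [hzZ] with r hr
      rw [hφd, hr, sub_smul]
    all_goals
      have := continuous_deriv_smoothTransition
      exact (Continuous.continuousOn (by fun_prop)).integrableOn_Icc.mono_set Ioo_subset_Icc_self
  have hL : Tendsto (fun ε => -∫ r, deriv (φ ε) r • z r ∂timeMeasure T) (𝓝[>] 0)
      (𝓝 (Z t - Z s)) := by
    have h1 := ((tendsto_integral_deriv_smoothTransition_smul hZ t).sub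
      (tendsto_integral_deriv_smoothTransition_smul hZ s)).mono_left
      (nhdsWithin_le_nhds (s := Ioi 0))
    refine h1.congr' ?_
    filter_upwards [Ioo_mem_nhdsGT (sub_pos.2 ht)] with ε hε
    rw [hlhs ε hε, neg_sub]
  have hR : Tendsto (fun ε => ∫ r, φ ε r • z' r ∂timeMeasure T) (𝓝[>] 0)
      (𝓝 (∫ r, ((Ioi s).indicator 1 r - (Ioi t).indicator 1 r : ℝ) • z' r ∂timeMeasure T)) := by
    refine tendsto_integral_filter_of_dominated_convergence (fun r => ‖z' r‖) ?_ ?_ hz'.norm ?_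
    · exact Eventually.of_forall fun ε =>
        (hφs ε).continuous.aestronglyMeasurable.smul hz'.aestronglyMeasurable
    · refine Eventually.of_forall fun ε => Eventually.of_forall fun r => ?_
      rw [norm_smul]
      refine mul_le_of_le_one_left (norm_nonneg _) ?_
      rw [Real.norm_eq_abs, abs_le]
      have h1 := Real.smoothTransition.nonneg (ε⁻¹ * (r - s))
      have h2 := Real.smoothTransition.nonneg (ε⁻¹ * (r - t))
      have h3 := Real.smoothTransition.le_one (ε⁻¹ * (r - s))
      have h4 := Real.smoothTransition.le_one (ε⁻¹ * (r - t))
      constructor <;> simp only [φ] <;> linarith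
    · exact Eventually.of_forall fun r => ((tendsto_smoothTransition_scaled s r).sub
        (tendsto_smoothTransition_scaled t r)).smul_const _
  have hE := tendsto_nhds_unique_of_eventuallyEq hL hR (by
    filter_upwards [Ioo_mem_nhdsGT (sub_pos.2 ht)] with ε hε
    refine h (φ ε) (hφs ε) ?_ ?_
    · exact HasCompactSupport.of_support_subset_isCompact isCompact_Icc
        ((subset_tsupport _).trans (hsupp ε hε.1))
    · exact (hsupp ε hε.1).trans (Icc_subset_Ioo hs (by linarith [hε.2])))
  rw [hE, intervalIntegral.integral_of_le hst, ← integral_indicator measurableSet_Ioc,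
    timeMeasure, ← integral_indicator measurableSet_Ioo]
  congr 1
  ext r
  by_cases h1 : s < r <;> by_cases h2 : t < r
  · simp [indicator, h1, h2, not_le.2 h2]
  · have : r ∈ Ioo 0 T := ⟨by linarith, by linarith⟩
    simp [indicator, h1, h2, not_lt.1 h2, this.1, this.2]
  · linarith
  · simp [indicator, h1, h2]

/-- Test functions vanish near 0 and T, so only interior points are reached directly. There `Z`
minus the primitive of z' is constant, and continuity carries this to the closed interval. -/
theorem IsWeakDeriv.sub_eq_integral [CompleteSpace E] {T : ℝ} (hT : 0 < T) {z z' Z : ℝ → E}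
    (h : IsWeakDeriv T z z') (hz' : Integrable z' (timeMeasure T)) (hZ : Continuous Z)
    (hzZ : ∀ᵐ t ∂timeMeasure T, z t = Z t) {s t : ℝ} (hs : s ∈ Icc 0 T) (ht : t ∈ Icc 0 T) :
    Z t - Z s = ∫ r in s..t, (Ioo 0 T).indicator z' r := by
  set F := (Ioo 0 T).indicator z'
  have hF : Integrable F := (integrable_indicator_iff measurableSet_Ioo).2 hz'
  have hFi : ∀ x y, IntervalIntegrable F volume x y := fun x y => hF.intervalIntegrable
  have hP : Continuous fun x => ∫ r in (0 : ℝ)..x, F r :=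
    intervalIntegral.continuous_primitive hFi 0
  have hmid : ∀ x ∈ Ioo 0 T, Z x - ∫ r in (0 : ℝ)..x, F r =
      Z (T / 2) - ∫ r in (0 : ℝ)..(T / 2), F r := by
    have hlt : ∀ x ∈ Ioo 0 T, ∀ y ∈ Ioo 0 T, x ≤ y → Z x - ∫ r in (0 : ℝ)..x, F r =
        Z y - ∫ r in (0 : ℝ)..y, F r := fun x hx y hy hxy => by
      have h1 := h.sub_eq_integral_of_mem_Ioo hz' hZ hzZ hx.1 hxy hy.2
      have h2 : ∫ r in x..y, z' r = ∫ r in x..y, F r := by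
        refine intervalIntegral.integral_congr fun r hr => ?_
        rw [uIcc_of_le hxy] at hr
        exact (indicator_of_mem (Icc_subset_Ioo hx.1 hy.2 hr) z').symm
      rw [h2, ← intervalIntegral.integral_interval_sub_left (hFi 0 y) (hFi 0 x)] at h1
      rw [sub_eq_sub_iff_sub_eq_sub, ← neg_sub, h1, neg_sub]
    intro x hx
    have hm : T / 2 ∈ Ioo 0 T := ⟨by linarith, by linarith⟩
    rcases le_total x (T / 2) with hle | hle
    · exact hlt x hx _ hm hle
    · exact (hlt _ hm x hx hle).symm
  have hcl : EqOn (fun x => Z x - ∫ r in (0 : ℝ)..x, F r)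
      (fun _ => Z (T / 2) - ∫ r in (0 : ℝ)..(T / 2), F r) (closure (Ioo 0 T)) :=
    EqOn.closure hmid (hZ.sub hP) continuous_const
  rw [closure_Ioo hT.ne] at hcl
  have h3 := (hcl hs).trans (hcl ht).symm
  simp only at h3
  rw [← intervalIntegral.integral_interval_sub_left (hFi 0 t) (hFi 0 s)]
  rw [sub_eq_sub_iff_sub_eq_sub] at h3
  rw [← neg_sub, h3, neg_sub]

end SmoothTransition

/-! ### Positive and negative parts in L² -/

section LatticeL2

variable {Ω : Type*} [MeasurableSpace Ω] {μ : Measure Ω}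

theorem inner_nonneg_of_nonneg {x y : Lp ℝ 2 μ} (hx : 0 ≤ x) (hy : 0 ≤ y) : 0 ≤ inner ℝ x y := by
  rw [L2.inner_def]
  refine integral_nonneg_of_ae ?_
  filter_upwards [(Lp.coeFn_nonneg x).2 hx, (Lp.coeFn_nonneg y).2 hy] with a h1 h2
  simpa using mul_nonneg h2 h1

theorem inner_eq_zero_of_inf_eq_zero {x y : Lp ℝ 2 μ} (h : x ⊓ y = 0) : inner ℝ x y = 0 := by
  rw [L2.inner_def]
  refine integral_eq_zero_of_ae ?_
  have h0 := Lp.coeFn_inf x y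
  rw [h] at h0
  filter_upwards [h0, Lp.coeFn_zero ℝ 2 μ] with a h1 h2
  rw [h2, Pi.zero_apply, Pi.inf_apply] at h1
  rcases min_choice (x a) (y a) with h3 | h3
  · have : x a = 0 := by rw [← h3]; exact h1.symm
    simp [this]
  · have : y a = 0 := by rw [← h3]; exact h1.symm
    simp [this]

theorem inner_posPart_negPart (x : Lp ℝ 2 μ) : inner ℝ x⁻ x⁺ = 0 := by
  rw [real_inner_comm]
  exact inner_eq_zero_of_inf_eq_zero (posPart_inf_negPart_eq_zero x)

/-- The subgradient inequality for the convex function x ↦ ‖x⁺‖²/2, whose gradient is x⁺. It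
replaces the chain rule. -/
theorem half_norm_posPart_sq_sub_le (x y : Lp ℝ 2 μ) :
    ‖x⁺‖ ^ 2 / 2 - ‖y⁺‖ ^ 2 / 2 ≤ inner ℝ (x - y) x⁺ := by
  have h1 : inner ℝ x x⁺ = ‖x⁺‖ ^ 2 := by
    conv_lhs => rw [← posPart_sub_negPart x]
    rw [inner_sub_left, posPart_sub_negPart, inner_posPart_negPart, sub_zero,
      real_inner_self_eq_norm_sq]
  have h2 : inner ℝ y x⁺ = inner ℝ y⁺ x⁺ - inner ℝ y⁻ x⁺ := by
    rw [← inner_sub_left, posPart_sub_negPart]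
  have h3 : 0 ≤ inner ℝ y⁻ x⁺ := inner_nonneg_of_nonneg (negPart_nonneg y) (posPart_nonneg x)
  have h4 := real_inner_le_norm y⁺ x⁺
  rw [inner_sub_left, h1, h2]
  nlinarith [sq_nonneg (‖x⁺‖ - ‖y⁺‖)]

theorem posPart_sub_of_inf_eq_zero {x y : Lp ℝ 2 μ} (h : x ⊓ y = 0) :
    (x - y)⁺ = x ∧ (x - y)⁻ = y := by
  have h1 : (x - y)⁺ = x := by
    have := inf_eq_sub_posPart_sub x y
    rw [h, eq_comm, sub_eq_zero] at this
    exact this.symm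
  refine ⟨h1, ?_⟩
  have h2 := posPart_sub_negPart (x - y)
  rw [h1] at h2
  exact sub_right_injective h2

theorem posPart_inf_negPart_eq_zero_of_le {x w : Lp ℝ 2 μ} (hw : 0 ≤ w) (h : w ≤ x⁺) :
    w ⊓ x⁻ = 0 :=
  le_antisymm ((inf_le_inf_right _ h).trans_eq (posPart_inf_negPart_eq_zero x))
    (le_inf hw (negPart_nonneg x))

theorem posPart_posPart_sub {x y : Lp ℝ 2 μ} (hy : 0 ≤ y) : (x⁺ - y)⁺ = (x - y)⁺ := by
  rw [posPart_def, posPart_def, posPart_def, sup_sub, zero_sub, sup_assoc,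
    sup_eq_right.2 (neg_nonpos.2 hy)]

end LatticeL2

/-! ### Gronwall's inequality and a criterion for nonpositivity -/

/-- Gronwall's inequality in integral form with zero initial value. -/
theorem eq_zero_of_le_mul_integral {φ : ℝ → ℝ} (hφ : Continuous φ) (h0 : ∀ t, 0 ≤ φ t) {κ T : ℝ}
    (hκ : 0 ≤ κ) (h : ∀ t ∈ Icc 0 T, φ t ≤ κ * ∫ r in (0 : ℝ)..t, φ r) {t : ℝ}
    (ht : t ∈ Icc 0 T) : φ t = 0 := by
  have hd : ∀ x, HasDerivAt (fun t => ∫ r in (0 : ℝ)..t, φ r) (φ x) x := fun x =>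
    intervalIntegral.integral_hasDerivAt_right (hφ.intervalIntegrable _ _)
      (hφ.stronglyMeasurableAtFilter _ _) hφ.continuousAt
  have hnn : ∀ x ∈ Icc 0 T, 0 ≤ ∫ r in (0 : ℝ)..x, φ r := fun x hx =>
    intervalIntegral.integral_nonneg hx.1 fun r _ => h0 r
  have hG := norm_le_gronwallBound_of_norm_deriv_right_le (a := 0) (b := T) (δ := 0) (K := κ)
    (ε := 0) (f := fun t => ∫ r in (0 : ℝ)..t, φ r) (f' := φ)
    (fun x _ => (hd x).continuousAt.continuousWithinAt)
    (fun x _ => (hd x).hasDerivWithinAt) (by simp)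
    (fun x hx => by
      have hx' := Ico_subset_Icc_self hx
      rw [Real.norm_of_nonneg (h0 x), Real.norm_of_nonneg (hnn x hx'), add_zero]
      exact h x hx') t ht
  have h1 : ∫ r in (0 : ℝ)..t, φ r ≤ 0 := by
    refine (le_abs_self _).trans (hG.trans_eq ?_)
    simp [gronwallBound_ε0]
  exact le_antisymm ((h t ht).trans (mul_nonpos_of_nonneg_of_nonpos hκ h1)) (h0 t)

section BackwardQuotient

variable {Ω : Type*} [MeasurableSpace Ω] {μ : Measure Ω}

/-- A continuous `L²`-valued function that starts nonpositive, and for which `⟨x', x⁺⟩` is a.e.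
controlled by `‖x⁺‖²`, stays nonpositive. -/
theorem nonpos_of_backward_quotient {x : ℝ → Lp ℝ 2 μ} (hx : Continuous x) {T κ : ℝ}
    (hx0 : x 0 ≤ 0) (hκ : 0 ≤ κ) {K c : ℝ → ℝ} (hK : Integrable K)
    (hc : IntegrableOn c (Ioo 0 T))
    (hbound : ∀ᵐ t ∂timeMeasure T, ∀ h, 0 < h → h < t →
      inner ℝ (x t - x (t - h)) (x t)⁺ ≤ (∫ r in (t - h)..t, K r) + h * c t)
    (hlim : ∀ᵐ t ∂timeMeasure T, ∀ ε > 0, ∀ᶠ h in 𝓝[>] (0 : ℝ),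
      inner ℝ (x t - x (t - h)) (x t)⁺ ≤ h * (κ * ‖(x t)⁺‖ ^ 2 + ε)) {t : ℝ}
    (ht : t ∈ Icc 0 T) : x t ≤ 0 := by
  let φ : ℝ → ℝ := fun t => ‖(x t)⁺‖ ^ 2 / 2
  have hφ : Continuous φ := ((continuous_posPart.comp hx).norm.pow 2).div_const 2
  have hφ0 : φ 0 = 0 := by simp [φ, posPart_eq_zero.2 hx0]
  have hKi : ∀ a b, IntervalIntegrable K volume a b := fun a b => hK.intervalIntegrable
  let P : ℝ → ℝ := fun t => ∫ r in (0 : ℝ)..t, K r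
  have hP : Continuous P := intervalIntegral.continuous_primitive hKi 0
  have hPd : ∀ᵐ t, HasDerivAt P (K t) t := by
    filter_upwards [LocallyIntegrable.ae_hasDerivAt_integral hK.locallyIntegrable] with t ht using ht 0
  have hPsub : ∀ a b, P b - P a = ∫ r in a..b, K r := fun a b =>
    intervalIntegral.integral_interval_sub_left (hKi 0 b) (hKi 0 a)
  have hstep : ∀ a b, 0 < a → a ≤ b → b < T →
      φ b - φ a ≤ ∫ r in a..b, 2 * κ * φ r := by
    intro a b ha hab hb
    have hsub : Ioc a b ⊆ Ioo 0 T := fun r hr => ⟨ha.trans hr.1, hr.2.trans_lt hb⟩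
    have hac : volume.restrict (Ioc a b) ≤ timeMeasure T := Measure.restrict_mono hsub le_rfl
    have hφi : IntervalIntegrable (fun r => 2 * κ * φ r) volume a b :=
      (continuous_const.mul hφ).intervalIntegrable _ _
    -- The quotients of φ are bounded from above, up to those of `P`; hence the lemma is applied to
    -- `P - φ`, and `P` cancels afterwards. Taking δ = a keeps t - h positive.
    have h1 := integral_le_sub_of_dini (Ψ := fun t => P t - φ t)
      (K := fun t => K t - 2 * κ * φ t) (c := c) (hP.sub hφ) hab ha
      (hK.integrableOn.sub (intervalIntegrable_iff_integrableOn_Ioc_of_le hab |>.1 hφi))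
      (hc.mono_set hsub) ?_ ?_
    · rw [intervalIntegral.integral_sub (hKi a b) hφi, ← hPsub] at h1
      linarith
    · filter_upwards [ae_mono hac hbound, ae_restrict_mem measurableSet_Ioc] with t ht htm h hh
      have h2 := ht h hh.1 (hh.2.trans htm.1)
      have h3 := half_norm_posPart_sq_sub_le (x t) (x (t - h))
      have h4 := hPsub (t - h) t
      change -(h * c t) ≤ (P t - ‖(x t)⁺‖ ^ 2 / 2) - (P (t - h) - ‖(x (t - h))⁺‖ ^ 2 / 2)
      linarith
    · filter_upwards [ae_mono hac hlim, ae_restrict_of_ae hPd] with t ht hPt ε hε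
      have h5 : Tendsto (fun h => h⁻¹ * (P t - P (t - h))) (𝓝[>] 0) (𝓝 (K t)) := by
        have h6 : HasDerivAt (fun h => -P (t - h)) (K t) 0 := by
          have h7 : HasDerivAt P (K t) (t - 0) := by simpa using hPt
          have h8 := (h7.comp (0 : ℝ) ((hasDerivAt_id (0 : ℝ)).const_sub t)).neg
          rwa [mul_neg, mul_one, neg_neg] at h8
        have h9 := h6.tendsto_slope_zero_right
        refine h9.congr fun h => ?_
        simp only [zero_add, sub_zero, smul_eq_mul]
        ring
      filter_upwards [ht (ε / 2) (half_pos hε), h5.eventually (lt_mem_nhds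
        (show K t - ε / 2 < K t by linarith)), self_mem_nhdsWithin] with h h1 h2 h3
      have h3' : 0 < h := h3
      have h4 := half_norm_posPart_sq_sub_le (x t) (x (t - h))
      have h6 := mul_le_mul_of_nonneg_left h2.le h3'.le
      rw [mul_inv_cancel_left₀ h3'.ne'] at h6
      change h * (K t - 2 * κ * (‖(x t)⁺‖ ^ 2 / 2) - ε) ≤
        (P t - ‖(x t)⁺‖ ^ 2 / 2) - (P (t - h) - ‖(x (t - h))⁺‖ ^ 2 / 2)
      nlinarith
  have hφi : ∀ a b, IntervalIntegrable (fun r => 2 * κ * φ r) volume a b := fun a b =>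
    (continuous_const.mul hφ).intervalIntegrable _ _
  have hQ : Continuous fun b => ∫ r in (0 : ℝ)..b, 2 * κ * φ r :=
    intervalIntegral.continuous_primitive hφi 0
  set G : ℝ → ℝ := fun b => (∫ r in (0 : ℝ)..b, 2 * κ * φ r) - φ b
  have hG : Continuous G := hQ.sub hφ
  rcases (ht.1.trans ht.2).eq_or_lt with hT | hT
  · rw [← hT] at ht
    rwa [le_antisymm ht.2 ht.1]
  -- Let a → 0 in `hstep`; the endpoints of [0, T] follow because {G ≥ 0} is closed.
  have hGnn : Ioo 0 T ⊆ {b | 0 ≤ G b} := by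
    intro b hb
    have h0 : Tendsto G (𝓝[>] 0) (𝓝 0) := by
      have : G 0 = 0 := by simp [G, hφ0]
      simpa [this] using (hG.tendsto 0).mono_left nhdsWithin_le_nhds
    refine le_of_tendsto h0 ?_
    filter_upwards [Ioo_mem_nhdsGT hb.1] with a ha
    have h1 := hstep a b ha.1 ha.2.le hb.2
    rw [← intervalIntegral.integral_interval_sub_left (hφi 0 b) (hφi 0 a)] at h1
    simp only [G]
    linarith
  have hGcl := closure_minimal hGnn (isClosed_le continuous_const hG)
  rw [closure_Ioo hT.ne] at hGcl
  have hzero : φ t = 0 := by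
    refine eq_zero_of_le_mul_integral hφ (fun r => by positivity)
      (mul_nonneg zero_le_two hκ) (fun r hr => ?_) ht
    have := hGcl hr
    rw [mem_ofPred_eq] at this
    rw [← intervalIntegral.integral_const_mul]
    simp only [G] at this
    linarith
  have : (x t)⁺ = 0 := by simpa [φ] using hzero
  exact posPart_eq_zero.1 this

end BackwardQuotient

/-! ### Difference quotients of solutions against fixed test elements -/

section TestedDeriv

theorem integrable_indicator_of_timeMeasure {E : Type*} [NormedAddCommGroup E] {T : ℝ} {f : ℝ → E}
    (hf : Integrable f (timeMeasure T)) : Integrable ((Ioo 0 T).indicator f) :=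
  (integrable_indicator_iff measurableSet_Ioo).2 hf

variable {V H : Type*} [NormedAddCommGroup V] [InnerProductSpace ℝ V]
  [NormedAddCommGroup H] [InnerProductSpace ℝ H]

/-- `U` is continuous with values in `H`, and `F ∈ L²(ℝ;V')` is its `V'`-valued derivative
on `[0,T]`, in integrated form. -/
structure HasDualDeriv (T : ℝ) (j : V →L[ℝ] H) (U : ℝ → H) (F : ℝ → StrongDual ℝ V) : Prop where
  continuous : Continuous U
  integrable : Integrable F
  integrable_sq : Integrable fun r => ‖F r‖ ^ 2
  inner_sub : ∀ s ∈ Icc 0 T, ∀ t ∈ Icc 0 T, ∀ z,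
    inner ℝ (U t - U s) (j z) = (∫ r in s..t, F r) z

/-- Young's inequality separates `F` from `w`. This matters because `w` will depend on t: the first
term is an increment of a primitive, the second is linear in h. -/
theorem HasDualDeriv.abs_inner_le {T : ℝ} {j : V →L[ℝ] H} {U : ℝ → H} {F : ℝ → StrongDual ℝ V}
    (hU : HasDualDeriv T j U F) {t h : ℝ} (ht : t ∈ Ioo 0 T) (h0 : 0 < h) (hht : h < t) (w : V) :
    |inner ℝ (U t - U (t - h)) (j w)| ≤ (∫ r in (t - h)..t, ‖F r‖ ^ 2 / 2) + h * (‖w‖ ^ 2 / 2) := by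
  rw [hU.inner_sub (t - h) ⟨by linarith, by linarith [ht.2]⟩ t ⟨ht.1.le, ht.2.le⟩ w]
  have hle : t - h ≤ t := by linarith
  have hi : IntervalIntegrable (fun r => ‖F r‖ ^ 2 / 2) volume (t - h) t :=
    (hU.integrable_sq.div_const 2).intervalIntegrable
  calc |(∫ r in (t - h)..t, F r) w| ≤ ‖∫ r in (t - h)..t, F r‖ * ‖w‖ :=
        (∫ r in (t - h)..t, F r).le_opNorm w
    _ ≤ (∫ r in (t - h)..t, ‖F r‖) * ‖w‖ := by
        gcongr
        exact intervalIntegral.norm_integral_le_integral_norm hle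
    _ = ∫ r in (t - h)..t, ‖F r‖ * ‖w‖ := (intervalIntegral.integral_mul_const _ _).symm
    _ ≤ ∫ r in (t - h)..t, (‖F r‖ ^ 2 / 2 + ‖w‖ ^ 2 / 2) := by
        refine intervalIntegral.integral_mono_on hle
          (hU.integrable.norm.mul_const _).intervalIntegrable
          (hi.add intervalIntegrable_const) fun r _ => ?_
        nlinarith [sq_nonneg (‖F r‖ - ‖w‖)]
    _ = _ := by
        rw [intervalIntegral.integral_add hi intervalIntegrable_const,
          intervalIntegral.integral_const, sub_sub_cancel, smul_eq_mul]

/-- Differentiating the primitive in the norm of V' gives one null set valid for all `w` at once, so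
a test element depending on t is allowed. -/
theorem HasDualDeriv.tendsto_quotient {T : ℝ} {j : V →L[ℝ] H} {U : ℝ → H}
    {F : ℝ → StrongDual ℝ V} (hU : HasDualDeriv T j U F) :
    ∀ᵐ t ∂timeMeasure T, ∀ w, Tendsto (fun h => h⁻¹ * inner ℝ (U t - U (t - h)) (j w))
      (𝓝[>] 0) (𝓝 (F t w)) := by
  filter_upwards [ae_restrict_of_ae
    (LocallyIntegrable.ae_hasDerivAt_integral hU.integrable.locallyIntegrable),
    ae_restrict_mem measurableSet_Ioo] with t ht htm w
  have hd : HasDerivAt (fun h : ℝ => -∫ r in t..(t - h), F r) (F t) 0 := by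
    have h1 : HasDerivAt (fun x => ∫ r in t..x, F r) (F t) (t - 0) := by simpa using ht t
    have h2 := (h1.scomp (0 : ℝ) ((hasDerivAt_id (0 : ℝ)).const_sub t)).neg
    rwa [neg_smul, one_smul, neg_neg] at h2
  have h3 := hd.tendsto_slope_zero_right
  have h4 := ((ContinuousLinearMap.apply ℝ ℝ w).continuous.tendsto (F t)).comp h3
  refine h4.congr' ?_
  filter_upwards [Ioo_mem_nhdsGT htm.1] with h hh
  rw [hU.inner_sub (t - h) ⟨by linarith [hh.2], by linarith [hh.1, htm.2]⟩ t ⟨htm.1.le, htm.2.le⟩ w]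
  simp [intervalIntegral.integral_symm t (t - h)]

/-- A solution has a continuous extension to `ℝ` whose `V'`-valued derivative is `f - A y`. -/
theorem IsSolution.exists_hasDualDeriv {T : ℝ} (hT : 0 < T) {j : V →L[ℝ] H}
    {a : ℝ → V →ₗ[ℝ] V →ₗ[ℝ] ℝ} {f : ℝ → StrongDual ℝ V} {u₀ : H} {u : ℝ → H}
    (hu : IsSolution T j a f u₀ u) :
    ∃ (U : ℝ → H) (F : ℝ → StrongDual ℝ V) (y : ℝ → V), HasDualDeriv T j U F ∧
      EqOn U u (Icc 0 T) ∧ U 0 = u₀ ∧ MemLp y 2 (timeMeasure T) ∧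
      (∀ᵐ t ∂timeMeasure T, U t = j (y t)) ∧
      ∀ᵐ t ∂timeMeasure T, ∀ z, F t z = f t z - a t (y t) z := by
  obtain ⟨hcont, h0, y, y', hMR, hy, heq⟩ := hu
  have : IsFiniteMeasure (timeMeasure T) := by
    unfold timeMeasure
    infer_instance
  let U : ℝ → H := IccExtend hT.le ((Icc 0 T).domRestrict u)
  have hU : Continuous U := hcont.domRestrict.Icc_extend'
  have hUu : EqOn U u (Icc 0 T) := fun t ht => IccExtend_of_mem hT.le _ ht
  have hUy : ∀ᵐ t ∂timeMeasure T, U t = j (y t) := by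
    filter_upwards [hy, ae_restrict_mem measurableSet_Ioo] with t ht htm
    rw [hUu ⟨htm.1.le, htm.2.le⟩, ht]
  let J : H →L[ℝ] StrongDual ℝ V := (ContinuousLinearMap.compL ℝ V H ℝ).flip j ∘L innerSL ℝ
  have hJ : ∀ h z, J h z = inner ℝ h (j z) := fun h z => rfl
  have hint : Integrable y' (timeMeasure T) := hMR.memLp_deriv.integrable one_le_two
  have hF : Integrable ((Ioo 0 T).indicator y') :=
    integrable_indicator_of_timeMeasure hint
  refine ⟨U, (Ioo 0 T).indicator y', y, ⟨hU, hF, ?_, ?_⟩, hUu, ?_, hMR.memLp, hUy, ?_⟩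
  · have h1 : Integrable ((Ioo 0 T).indicator fun r => ‖y' r‖ ^ 2) :=
      integrable_indicator_of_timeMeasure hMR.memLp_deriv.norm.integrable_sq
    refine h1.congr (Eventually.of_forall fun r => ?_)
    by_cases hr : r ∈ Ioo 0 T <;> simp [indicator, hr]
  · intro s hs t ht z
    have h1 := hMR.weakDeriv.sub_eq_integral hT hint (Z := fun t => J (U t))
      (J.continuous.comp hU) (by
        filter_upwards [hUy] with t ht
        ext z
        simp [hJ, ht, embedDual]) hs ht
    rw [← h1, ← map_sub, hJ]
  · rw [hUu ⟨le_rfl, hT.le⟩, h0]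
  · filter_upwards [heq, ae_restrict_mem measurableSet_Ioo] with t ht htm z
    rw [indicator_of_mem htm]
    linarith [ht z]

end TestedDeriv

/-! ### Continuity of the inclusion of V in W -/

section Inclusion

variable {V W H : Type*} [NormedAddCommGroup V] [InnerProductSpace ℝ V] [CompleteSpace V]
  [NormedAddCommGroup W] [InnerProductSpace ℝ W] [CompleteSpace W]
  [NormedAddCommGroup H] [InnerProductSpace ℝ H]

/-- An inclusion of continuously embedded complete spaces is continuous. -/
theorem exists_inclusion {j : V →L[ℝ] H} {k : W →L[ℝ] H} (hk : Function.Injective k)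
    (h : range j ⊆ range k) : ∃ i : V →L[ℝ] W, ∀ v, k (i v) = j v := by
  choose i hi using fun v => h (mem_range_self v)
  let L : V →ₗ[ℝ] W :=
    { toFun := i
      map_add' := fun x y => hk (by simp [hi])
      map_smul' := fun c x => hk (by simp [hi]) }
  refine ⟨⟨L, L.continuous_of_seq_closed_graph fun u x y hu hLu => hk ?_⟩, hi⟩
  have h1 : Tendsto (fun n => j (u n)) atTop (𝓝 (j x)) := (j.continuous.tendsto x).comp hu
  have h2 : Tendsto (fun n => k (i (u n))) atTop (𝓝 (k y)) := (k.continuous.tendsto y).comp hLu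
  simp_rw [hi] at h2
  exact (tendsto_nhds_unique h2 h1).trans (hi x).symm

end Inclusion

/-! ### Estimates for the forms at a fixed time -/

section Forms

variable {Ω : Type*} [MeasurableSpace Ω] {μ : Measure Ω}
  {V W : Type*} [NormedAddCommGroup V] [InnerProductSpace ℝ V]
  [NormedAddCommGroup W] [InnerProductSpace ℝ W]

/-- A bounded quasi-coercive form satisfying the first Beurling-Deny criterion. -/
structure IsPositiveForm (j : V →L[ℝ] Lp ℝ 2 μ) (a : V →ₗ[ℝ] V →ₗ[ℝ] ℝ) (M α κ : ℝ) : Prop where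
  pos : 0 < α
  bounded : ∀ u v, |a u v| ≤ M * ‖u‖ * ‖v‖
  quasiCoercive : ∀ u, α * ‖u‖ ^ 2 ≤ a u u + κ * ‖j u‖ ^ 2
  apply_posPart_negPart : ∀ v p m, j p = (j v)⁺ → j m = (j v)⁻ → a p m ≤ 0

variable {j : V →L[ℝ] Lp ℝ 2 μ} {k : W →L[ℝ] Lp ℝ 2 μ}
  {a : V →ₗ[ℝ] V →ₗ[ℝ] ℝ} {b : W →ₗ[ℝ] W →ₗ[ℝ] ℝ} {M α κ M' β κ' : ℝ}

theorem IsPositiveForm.apply_le (ha : IsPositiveForm j a M α κ) (u v : V) :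
    a u v ≤ M * ‖u‖ * ‖v‖ := (le_abs_self _).trans (ha.bounded u v)

theorem IsPositiveForm.neg_apply_self_le (ha : IsPositiveForm j a M α κ) (u : V) :
    -a u u ≤ κ * ‖j u‖ ^ 2 := by
  have := ha.quasiCoercive u
  have := mul_nonneg ha.pos.le (sq_nonneg ‖u‖)
  linarith

theorem IsPositiveForm.apply_nonpos_of_inf_eq_zero (ha : IsPositiveForm j a M α κ) {p m : V}
    (h : j p ⊓ j m = 0) : a p m ≤ 0 := by
  have h1 := posPart_sub_of_inf_eq_zero h
  exact ha.apply_posPart_negPart (p - m) p m (by rw [map_sub, h1.1]) (by rw [map_sub, h1.2])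

/-- The first Beurling-Deny criterion gives a(v⁺, v⁺) ≤ a(v, v⁺); coercivity on the left and
boundedness on the right then leave one factor ‖v⁺‖ to cancel. -/
theorem IsPositiveForm.mul_norm_posPart_le (ha : IsPositiveForm j a M α κ) {v p : V}
    (hp : j p = (j v)⁺) : α * ‖p‖ ≤ (M + |κ| * ‖j‖ ^ 2) * ‖v‖ := by
  have hm : j (p - v) = (j v)⁻ := by
    rw [map_sub, hp, sub_eq_iff_eq_add, ← sub_eq_iff_eq_add', posPart_sub_negPart]
  have h1 : a (p - v) p ≤ 0 := ha.apply_nonpos_of_inf_eq_zero (by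
    rw [hm, hp, inf_comm, posPart_inf_negPart_eq_zero])
  rw [map_sub, LinearMap.sub_apply] at h1
  have h2 := ha.quasiCoercive p
  have h3 := ha.apply_le v p
  have h4 : κ * ‖j p‖ ^ 2 ≤ |κ| * ‖j‖ ^ 2 * ‖v‖ * ‖p‖ := by
    have h5 : ‖j p‖ ≤ ‖j v‖ := by
      rw [hp]
      refine norm_le_norm_of_abs_le_abs ?_
      rw [abs_of_nonneg (posPart_nonneg _), ← posPart_add_negPart]
      exact le_add_of_nonneg_right (negPart_nonneg _)
    calc κ * ‖j p‖ ^ 2 ≤ |κ| * ‖j p‖ ^ 2 := by gcongr; exact le_abs_self κ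
      _ = |κ| * (‖j p‖ * ‖j p‖) := by ring
      _ ≤ |κ| * ((‖j‖ * ‖v‖) * (‖j‖ * ‖p‖)) := by
        gcongr
        · exact h5.trans (j.le_opNorm v)
        · exact j.le_opNorm p
      _ = _ := by ring
  rcases (norm_nonneg p).eq_or_lt with h0 | h0
  -- `M` is not assumed nonnegative; unless v = 0, boundedness at (v, v) forces it.
  · have h6 := ha.bounded v v
    have h7 := (abs_nonneg _).trans h6
    rw [← h0, mul_zero]
    rcases (norm_nonneg v).eq_or_lt with h8 | h8
    · rw [← h8, mul_zero]
    · have h9 : 0 ≤ M := by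
        rw [mul_assoc] at h7
        exact nonneg_of_mul_nonneg_left h7 (mul_pos h8 h8)
      positivity
  · refine le_of_mul_le_mul_right ?_ h0
    nlinarith

theorem IsPositiveForm.exists_norm_posPart_le (ha : IsPositiveForm j a M α κ) :
    ∃ C, 0 ≤ C ∧ ∀ v p, j p = (j v)⁺ → ‖p‖ ≤ C * ‖v‖ := by
  refine ⟨|α⁻¹ * (M + |κ| * ‖j‖ ^ 2)|, abs_nonneg _, fun v p hp => ?_⟩
  refine le_trans ?_ (mul_le_mul_of_nonneg_right (le_abs_self _) (norm_nonneg v))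
  rw [mul_assoc, ← div_eq_inv_mul, le_div_iff₀ ha.pos, mul_comm]
  exact ha.mul_norm_posPart_le hp

theorem IsPositiveForm.apply_negPart_le (ha : IsPositiveForm j a M α κ) {v m : V}
    (hm : j m = (j v)⁻) : a v m ≤ κ * ‖j m‖ ^ 2 := by
  have hp : j (v + m) = (j v)⁺ := by
    rw [map_add, hm, ← sub_eq_iff_eq_add.1 (posPart_sub_negPart (j v))]
  have h1 := ha.apply_posPart_negPart v (v + m) m hp hm
  rw [map_add, LinearMap.add_apply] at h1
  linarith [ha.neg_apply_self_le m]

/-- The comparison `b ≤ a` on the positive cone, for an inclusion `i` of the form domains. -/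
def FormLEAt (j : V →L[ℝ] Lp ℝ 2 μ) (i : V →L[ℝ] W) (b : W →ₗ[ℝ] W →ₗ[ℝ] ℝ)
    (a : V →ₗ[ℝ] V →ₗ[ℝ] ℝ) : Prop :=
  ∀ u v, 0 ≤ j u → 0 ≤ j v → b (i u) (i v) ≤ a u v

variable {i : V →L[ℝ] W}

/-- Since w ≤ y⁺ is disjoint from y⁻, a(y⁻, w) ≤ 0, so -a(y, w) ≤ -a(y⁺, w) ≤ -b(y⁺, w). As z ≥ 0, w
is also the negative part of z - y⁺, and b(z - y⁺, w) is controlled by quasi-coercivity. -/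
theorem FormLEAt.apply_sub_apply_le (hba : FormLEAt j i b a) (ha : IsPositiveForm j a M α κ)
    (hb : IsPositiveForm k b M' β κ') (hi : ∀ v, k (i v) = j v) (hV : IsSublattice j)
    {y w : V} {z : W} (hz : 0 ≤ k z) (hw : j w = (j y - k z)⁺) :
    b z (i w) - a y w ≤ κ' * ‖j w‖ ^ 2 := by
  obtain ⟨p, hp⟩ := hV y
  have hwp : j w ≤ (j y)⁺ := by
    rw [hw]
    exact posPart_mono (sub_le_self _ hz)
  have hw0 : 0 ≤ j w := by
    rw [hw]
    exact posPart_nonneg _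
  have hm : j (p - y) = (j y)⁻ := by
    rw [map_sub, hp, sub_eq_iff_eq_add, ← sub_eq_iff_eq_add', posPart_sub_negPart]
  have h1 : a (p - y) w ≤ 0 := ha.apply_nonpos_of_inf_eq_zero (by
    rw [hm, inf_comm]
    exact posPart_inf_negPart_eq_zero_of_le hw0 hwp)
  have h2 := hba p w (by rw [hp]; exact posPart_nonneg _) hw0
  have h3 := hb.apply_negPart_le (v := z - i p) (m := i w) (by
    rw [hi, hw, map_sub, hi, hp, ← posPart_posPart_sub hz, ← neg_sub (k z), posPart_neg])
  rw [map_sub, LinearMap.sub_apply] at h1 h3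
  rw [hi] at h3
  linarith

/-- The element w is first bounded in W, as the positive part of y - z. The bound in V uses a(w, w)
= a(y⁺, w) - a(y⁺ - w, w) ≤ a(y⁺, w) - b(y⁺ - w, w), where both y⁺ - w and w are nonnegative. -/
theorem FormLEAt.exists_norm_le (hba : FormLEAt j i b a) (ha : IsPositiveForm j a M α κ)
    (hb : IsPositiveForm k b M' β κ') (hi : ∀ v, k (i v) = j v) (hV : IsSublattice j) :
    ∃ C, 0 ≤ C ∧ ∀ (y w : V) (z : W), 0 ≤ k z → j w = (j y - k z)⁺ → ‖w‖ ≤ C * (‖y‖ + ‖z‖) := by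
  obtain ⟨C₁, hC₁, h₁⟩ := ha.exists_norm_posPart_le
  obtain ⟨C₂, hC₂, h₂⟩ := hb.exists_norm_posPart_le
  let D := |M| * C₁ + |M'| * (‖i‖ * C₁ + C₂ * (‖i‖ + 1)) * ‖i‖ +
    |κ| * ‖k‖ * C₂ * (‖i‖ + 1) * ‖j‖
  have hD : 0 ≤ D := by positivity
  refine ⟨α⁻¹ * D, mul_nonneg (inv_nonneg.2 ha.pos.le) hD, fun y w z hz hw => ?_⟩
  obtain ⟨p, hp⟩ := hV y
  set N := ‖y‖ + ‖z‖
  have hyN : ‖y‖ ≤ N := le_add_of_nonneg_right (norm_nonneg z)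
  have hzN : ‖z‖ ≤ N := le_add_of_nonneg_left (norm_nonneg y)
  have hN : 0 ≤ N := (norm_nonneg y).trans hyN
  have hw0 : 0 ≤ j w := by
    rw [hw]
    exact posPart_nonneg _
  have hpw : 0 ≤ j (p - w) := by
    rw [map_sub, hp, hw, sub_nonneg]
    exact posPart_mono (sub_le_self _ hz)
  have hpN : ‖p‖ ≤ C₁ * N := (h₁ y p hp).trans (by gcongr)
  have hiw : ‖i w‖ ≤ C₂ * ((‖i‖ + 1) * N) := by
    refine (h₂ (i y - z) (i w) (by rw [hi, hw, map_sub, hi])).trans ?_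
    gcongr
    calc ‖i y - z‖ ≤ ‖i y‖ + ‖z‖ := norm_sub_le _ _
      _ ≤ ‖i‖ * N + N := add_le_add ((i.le_opNorm y).trans (by gcongr)) hzN
      _ = _ := by ring
  have hipw : ‖i (p - w)‖ ≤ ‖i‖ * (C₁ * N) + C₂ * ((‖i‖ + 1) * N) := by
    rw [map_sub]
    refine (norm_sub_le _ _).trans (add_le_add ((i.le_opNorm p).trans ?_) hiw)
    gcongr
  have h3 := hba (p - w) w hpw hw0
  rw [map_sub a, LinearMap.sub_apply] at h3
  have h4 : a p w ≤ |M| * (C₁ * N) * ‖w‖ := (ha.apply_le p w).trans (by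
    gcongr
    exact le_abs_self M)
  have h5 : -b (i (p - w)) (i w) ≤
      |M'| * (‖i‖ * (C₁ * N) + C₂ * ((‖i‖ + 1) * N)) * (‖i‖ * ‖w‖) := by
    refine (neg_le_abs _).trans ((hb.bounded _ _).trans ?_)
    gcongr
    · exact le_abs_self M'
    · exact i.le_opNorm w
  have h6 : κ * ‖j w‖ ^ 2 ≤ |κ| * ((‖k‖ * (C₂ * ((‖i‖ + 1) * N))) * (‖j‖ * ‖w‖)) := by
    have h7 : ‖j w‖ ≤ ‖k‖ * (C₂ * ((‖i‖ + 1) * N)) := by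
      rw [← hi w]
      exact (k.le_opNorm _).trans (by gcongr)
    rw [sq]
    gcongr
    · exact le_abs_self κ
    · exact j.le_opNorm w
  have h7 := ha.quasiCoercive w
  have h8 : α * ‖w‖ * ‖w‖ ≤ D * N * ‖w‖ := by
    simp only [D]
    nlinarith
  rw [mul_assoc, ← div_eq_inv_mul, le_div_iff₀ ha.pos, mul_comm]
  rcases (norm_nonneg w).eq_or_lt with h0 | h0
  · rw [← h0, mul_zero]
    positivity
  · exact le_of_mul_le_mul_right h8 h0

end Forms

theorem IsNonautonomousClosedForm.exists_isPositiveForm {Ω : Type*} [MeasurableSpace Ω]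
    {μ : Measure Ω} {V : Type*} [NormedAddCommGroup V] [InnerProductSpace ℝ V] {T : ℝ}
    {j : V →L[ℝ] Lp ℝ 2 μ} {a : ℝ → V →ₗ[ℝ] V →ₗ[ℝ] ℝ}
    (ha : IsNonautonomousClosedForm T j a) (hpos : IsPositivityPreserving T j a) :
    ∃ M α κ, 0 ≤ κ ∧ ∀ᵐ t ∂timeMeasure T, IsPositiveForm j (a t) M α κ := by
  obtain ⟨M, hM⟩ := ha.bounded
  obtain ⟨α, hα, κ, hκ⟩ := ha.quasiCoercive
  refine ⟨M, α, |κ|, abs_nonneg κ, ?_⟩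
  filter_upwards [hpos, ae_restrict_mem measurableSet_Ioo] with t ht htm
  have htm' : t ∈ Icc 0 T := Ioo_subset_Icc_self htm
  refine ⟨hα, hM t htm', fun u => (hκ t htm' u).trans ?_, ht⟩
  gcongr
  exact le_abs_self κ

/-! ### Positivity and domination of solutions -/

section Comparison

variable {Ω : Type*} [MeasurableSpace Ω] {μ : Measure Ω}
  {V W : Type*} [NormedAddCommGroup V] [InnerProductSpace ℝ V]
  [NormedAddCommGroup W] [InnerProductSpace ℝ W]

theorem timeMeasure_ne_zero {T : ℝ} (hT : 0 < T) : timeMeasure T ≠ 0 := by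
  rw [timeMeasure, Ne, Measure.restrict_eq_zero]
  simp [hT]

theorem eventually_le_mul_of_tendsto {q : ℝ → ℝ} {L B ε : ℝ}
    (hq : Tendsto (fun h => h⁻¹ * q h) (𝓝[>] 0) (𝓝 L)) (hL : L ≤ B) (hε : 0 < ε) :
    ∀ᶠ h in 𝓝[>] (0 : ℝ), q h ≤ h * (B + ε) := by
  filter_upwards [hq.eventually (gt_mem_nhds (show L < B + ε by linarith)), self_mem_nhdsWithin]
    with h h1 h2
  have h3 := mul_le_mul_of_nonneg_left h1.le (le_of_lt h2)
  rwa [mul_inv_cancel_left₀ (ne_of_gt h2)] at h3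

/-- Positivity of the solution for positive data. -/
theorem IsSolution.nonneg {T : ℝ} (hT : 0 < T) {k : W →L[ℝ] Lp ℝ 2 μ}
    {b : ℝ → W →ₗ[ℝ] W →ₗ[ℝ] ℝ} (hb : IsNonautonomousClosedForm T k b) (hW : IsSublattice k)
    (hb_pos : IsPositivityPreserving T k b) {v₀ : Lp ℝ 2 μ} (hv₀ : 0 ≤ v₀)
    {g : ℝ → StrongDual ℝ W} (hg_pos : IsPositive T k g) {v : ℝ → Lp ℝ 2 μ}
    (hv : IsSolution T k b g v₀ v) : ∀ t ∈ Icc 0 T, 0 ≤ v t := by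
  obtain ⟨U, G, z, hU, hUv, hU0, hz, hUz, hG⟩ := hv.exists_hasDualDeriv hT
  obtain ⟨M, β, κ, hκ, hform⟩ := hb.exists_isPositiveForm hb_pos
  have : (ae (timeMeasure T)).NeBot := ae_neBot.2 (timeMeasure_ne_zero hT)
  -- The resulting norm bound concerns only the space and its order, so the form at a single good
  -- time provides a constant for all t.
  obtain ⟨t₀, ht₀⟩ := hform.exists
  obtain ⟨C, hC, hCb⟩ := ht₀.exists_norm_posPart_le
  have hw : ∀ᵐ t ∂timeMeasure T, ∃ w, k w = (k (z t))⁻ ∧ k w = (-U t)⁺ ∧ ‖w‖ ≤ C * ‖z t‖ := by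
    filter_upwards [hUz] with t ht
    obtain ⟨w, hw⟩ := hW (-z t)
    refine ⟨w, ?_, ?_, ?_⟩
    · rw [hw, map_neg, posPart_neg]
    · rw [hw, map_neg, ht]
    · simpa using hCb (-z t) w hw
  intro t ht
  rw [← hUv ht, ← neg_nonpos]
  refine nonpos_of_backward_quotient (x := fun t => -U t) (K := fun r => ‖G r‖ ^ 2 / 2)
    (c := fun t => (C * ‖z t‖) ^ 2 / 2) (κ := κ) (T := T) hU.continuous.neg
    (by simpa [hU0] using hv₀) hκ (hU.integrable_sq.div_const 2)
    ((hz.norm.const_mul C).integrable_sq.div_const 2) ?_ ?_ ht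
  · filter_upwards [hw, ae_restrict_mem measurableSet_Ioo] with t ⟨w, _, hwU, hwC⟩ htm h h0 hht
    rw [← hwU, neg_sub_neg, ← neg_sub, inner_neg_left]
    refine (neg_le_abs _).trans ((hU.abs_inner_le htm h0 hht w).trans ?_)
    gcongr
  · filter_upwards [hw, hform, hG, hg_pos, hU.tendsto_quotient]
      with t ⟨w, hwz, hwU, _⟩ hbt hGt hgt hlim ε hε
    have h1 := (hlim w).neg
    simp_rw [← mul_neg] at h1
    refine (eventually_le_mul_of_tendsto h1 (B := κ * ‖(-U t)⁺‖ ^ 2) ?_ hε).mono fun h hh => ?_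
    · have h2 := hgt w (by rw [hwz]; exact negPart_nonneg _)
      have h3 := hbt.apply_negPart_le hwz
      rw [← hwU, hGt]
      linarith
    · rw [← hwU] at hh ⊢
      rwa [neg_sub_neg, ← neg_sub, inner_neg_left]

/-- Domination between solutions, once the dominating solution is known to be nonnegative. -/
theorem IsSolution.le_of_nonneg [CompleteSpace V] [CompleteSpace W] {T : ℝ} (hT : 0 < T)
    {j : V →L[ℝ] Lp ℝ 2 μ} {k : W →L[ℝ] Lp ℝ 2 μ} (hk : Function.Injective k)
    {a : ℝ → V →ₗ[ℝ] V →ₗ[ℝ] ℝ} (ha : IsNonautonomousClosedForm T j a)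
    {b : ℝ → W →ₗ[ℝ] W →ₗ[ℝ] ℝ} (hb : IsNonautonomousClosedForm T k b)
    (hV : IsSublattice j) (hW : IsSublattice k) (hVW : IsIdealOf j k)
    (ha_pos : IsPositivityPreserving T j a) (hb_pos : IsPositivityPreserving T k b)
    (hba : FormLE T j k b a) {u₀ v₀ : Lp ℝ 2 μ} (huv₀ : u₀ ≤ v₀)
    {f : ℝ → StrongDual ℝ V} {g : ℝ → StrongDual ℝ W} (hfg : SourceLE T j k f g)
    {u v : ℝ → Lp ℝ 2 μ} (hu : IsSolution T j a f u₀ u) (hv : IsSolution T k b g v₀ v)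
    (hv_nonneg : ∀ t ∈ Icc 0 T, 0 ≤ v t) : ∀ t ∈ Icc 0 T, u t ≤ v t := by
  obtain ⟨i, hi⟩ := exists_inclusion hk hVW.1
  obtain ⟨U, F, y, hU, hUu, hU0, hy, hUy, hF⟩ := hu.exists_hasDualDeriv hT
  obtain ⟨Z, G, z, hZ, hZv, hZ0, hz, hZz, hG⟩ := hv.exists_hasDualDeriv hT
  obtain ⟨Ma, α, κa, -, ha_form⟩ := ha.exists_isPositiveForm ha_pos
  obtain ⟨Mb, β, κ, hκ, hb_form⟩ := hb.exists_isPositiveForm hb_pos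
  have hle : ∀ᵐ t ∂timeMeasure T, FormLEAt j i (b t) (a t) := by
    filter_upwards [hba] with t ht p q hp hq using ht p q (i p) (i q) (hi p) (hi q) hp hq
  have : (ae (timeMeasure T)).NeBot := ae_neBot.2 (timeMeasure_ne_zero hT)
  obtain ⟨t₀, hta, htb, htle⟩ := (ha_form.and (hb_form.and hle)).exists
  obtain ⟨C, hC, hCb⟩ := htle.exists_norm_le hta htb hi hV
  have hz_nonneg : ∀ᵐ t ∂timeMeasure T, 0 ≤ k (z t) := by
    filter_upwards [hZz, ae_restrict_mem measurableSet_Ioo] with t ht htm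
    have htm' : t ∈ Icc 0 T := Ioo_subset_Icc_self htm
    rw [← ht, hZv htm']
    exact hv_nonneg t htm'
  -- The positive part is formed in W and lies in V by the ideal property, being dominated by y⁺.
  -- The choice of `w` need not be measurable in t: later only the norm bound, explicit in y and z,
  -- is integrated.
  have hw : ∀ᵐ t ∂timeMeasure T, ∃ w, j w = (j (y t) - k (z t))⁺ ∧ j w = (U t - Z t)⁺ ∧
      ‖w‖ ≤ C * (‖y t‖ + ‖z t‖) := by
    filter_upwards [hUy, hZz, hz_nonneg] with t hUt hZt hzt
    obtain ⟨p, hp⟩ := hV (y t)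
    obtain ⟨w', hw'⟩ := hW (i (y t) - z t)
    rw [map_sub, hi] at hw'
    obtain ⟨w, hw⟩ := hVW.2 p w' (by rw [hw']; exact posPart_nonneg _)
      (by rw [hw', hp]; exact posPart_mono (sub_le_self _ hzt))
    rw [hw'] at hw
    exact ⟨w, hw, by rw [hw, hUt, hZt], hCb (y t) w (z t) hzt hw⟩
  intro t ht
  rw [← hUu ht, ← hZv ht, ← sub_nonpos]
  refine nonpos_of_backward_quotient (x := fun t => U t - Z t)
    (K := fun r => ‖F r‖ ^ 2 / 2 + ‖G r‖ ^ 2 / 2)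
    -- Sum of the two Young terms, ‖w‖²/2 from V and ‖i w‖²/2 from W.
    (c := fun t => (1 + ‖i‖ ^ 2) / 2 * (C * (‖y t‖ + ‖z t‖)) ^ 2) (κ := κ) (T := T)
    (hU.continuous.sub hZ.continuous) (by simpa [hU0, hZ0] using huv₀) hκ
    ((hU.integrable_sq.div_const 2).add (hZ.integrable_sq.div_const 2))
    (((hy.norm.add hz.norm).const_mul C).integrable_sq.const_mul _) ?_ ?_ ht
  · filter_upwards [hw, ae_restrict_mem measurableSet_Ioo] with t ⟨w, _, hwU, hwC⟩ htm h h0 hht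
    have h1 := (le_abs_self _).trans (hU.abs_inner_le htm h0 hht w)
    have h2 := (neg_le_abs _).trans (hZ.abs_inner_le htm h0 hht (i w))
    rw [hi] at h2
    have h3 : ‖w‖ ^ 2 / 2 + ‖i w‖ ^ 2 / 2 ≤
        (1 + ‖i‖ ^ 2) / 2 * (C * (‖y t‖ + ‖z t‖)) ^ 2 := by
      calc ‖w‖ ^ 2 / 2 + ‖i w‖ ^ 2 / 2 ≤ ‖w‖ ^ 2 / 2 + (‖i‖ * ‖w‖) ^ 2 / 2 := by
            gcongr
            exact i.le_opNorm w
        _ = (1 + ‖i‖ ^ 2) / 2 * ‖w‖ ^ 2 := by ring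
        _ ≤ _ := by gcongr
    have h4 := mul_le_mul_of_nonneg_left h3 h0.le
    rw [intervalIntegral.integral_add (hU.integrable_sq.div_const 2).intervalIntegrable
      (hZ.integrable_sq.div_const 2).intervalIntegrable, ← hwU, sub_sub_sub_comm, inner_sub_left]
    linarith
  · filter_upwards [hw, ha_form, hb_form, hle, hF, hG, hfg, hU.tendsto_quotient,
      hZ.tendsto_quotient, hz_nonneg]
      with t ⟨w, hwz, hwU, _⟩ hat hbt hlet hFt hGt hfgt hlimU hlimZ hzt ε hε
    have h1 := (hlimU w).sub (hlimZ (i w))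
    simp_rw [← mul_sub] at h1
    refine (eventually_le_mul_of_tendsto h1 (B := κ * ‖(U t - Z t)⁺‖ ^ 2) ?_ hε).mono
      fun h hh => ?_
    · have h2 := hfgt w (i w) (hi w) (by rw [hwz]; exact posPart_nonneg _)
      have h3 := hlet.apply_sub_apply_le hat hbt hi hV hzt hwz
      rw [← hwU, hFt, hGt]
      linarith
    · rw [hi, ← inner_sub_left, hwU] at hh
      rwa [sub_sub_sub_comm]

end Comparison

end NonautForm

theorem mainTheorem5
    {Ω : Type*} [MeasurableSpace Ω] (μ : Measure Ω)
    {V : Type*} [NormedAddCommGroup V] [InnerProductSpace ℝ V] [CompleteSpace V]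
    {W : Type*} [NormedAddCommGroup W] [InnerProductSpace ℝ W] [CompleteSpace W]
    (T : ℝ) (hT : 0 < T)
    (j : V →L[ℝ] Lp ℝ 2 μ) (hj : NonautForm.IsDenseEmbedding j)
    (k : W →L[ℝ] Lp ℝ 2 μ) (hk : NonautForm.IsDenseEmbedding k)
    (a : ℝ → V →ₗ[ℝ] V →ₗ[ℝ] ℝ) (ha : NonautForm.IsNonautonomousClosedForm T j a)
    (b : ℝ → W →ₗ[ℝ] W →ₗ[ℝ] ℝ) (hb : NonautForm.IsNonautonomousClosedForm T k b)
    (hV : NonautForm.IsSublattice j) (hW : NonautForm.IsSublattice k)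
    (hVW : NonautForm.IsIdealOf j k)
    (ha_pos : NonautForm.IsPositivityPreserving T j a)
    (hb_pos : NonautForm.IsPositivityPreserving T k b)
    (hba : NonautForm.FormLE T j k b a)
    (u₀ v₀ : Lp ℝ 2 μ) (hu₀ : 0 ≤ u₀) (huv₀ : u₀ ≤ v₀)
    (f : ℝ → StrongDual ℝ V) (hf : MemLp f 2 (NonautForm.timeMeasure T))
    (g : ℝ → StrongDual ℝ W) (hg : MemLp g 2 (NonautForm.timeMeasure T))
    (hfg : NonautForm.SourceLE T j k f g) (hg_pos : NonautForm.IsPositive T k g)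
    (u v : ℝ → Lp ℝ 2 μ)
    (hu : NonautForm.IsSolution T j a f u₀ u)
    (hv : NonautForm.IsSolution T k b g v₀ v) :
    ∀ t ∈ Icc 0 T, u t ≤ v t := by
  exact hu.le_of_nonneg hT hk.injective ha hb hV hW hVW ha_pos hb_pos hba huv₀ hfg hv
    (hv.nonneg hT hb hW hb_pos (hu₀.trans huv₀) hg_pos)
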